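/- Let $n\ge 1$, $d\ge 1$, let $x_1,\dots,x_n,z,u\in\mathbb R^d$ with Euclidean norm $\|u\|=1$, let $\delta\ge 0$, and let $\mathbb P_n=\frac1n\sum_{i=1}^n\delta_{x_i}$ be the empirical law. For probability laws $\mathbb P,\mathbb P'$ on $\mathbb R^d$ let $d_W(\mathbb P',\mathbb P)=\inf_\Pi\int\|x-y\|\,\Pi(dx,dy)\in[0,\infty]$, where $\Pi$ runs over the joint laws with marginals $\mathbb P'$ and $\mathbb P$. Put $y_i=\langle u,z-x_i\rangle$ and denote the sorted values of the $y_i$ (with multiplicity) by $$y^{(-\underline m)}\le\dots\le y^{(-1)}\le 0<y^{(1)}\le\dots\le y^{(m)},\qquad m+\underline m=n,$$ and put $s_k=\sum_{j=1}^k y^{(j)}$, $\underline s_k=-\sum_{j=1}^k y^{(-j)}$ (so $s_0=\underline s_0=0$), and $p=\mathbb P_n(\{x:\langle u,x-z\rangle\ge 0\})$. (i) If $1\le k\le m$ is such that $s_{k-1}<\delta n\le s_k$, then $$\sup_{\mathbb P':\,d_W(\mathbb P',\mathbb P_n)\le\delta}\mathbb P'(\{x:\langle u,x-z\rangle\ge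 0\})=p+\frac{k-1}{n}+\frac{\delta-s_{k-1}/n}{y^{(k)}}\in\Big(p+\frac{k-1}n,\;p+\frac kn\Big].$$ If $s_m\le\delta n$, then this supremum equals $1$. (ii) If $1\le k\le\underline m$ is such that $\underline s_{k-1}<\delta n\le\underline s_k$, then $$\inf_{\mathbb P':\,d_W(\mathbb P',\mathbb P_n)\le\delta}\mathbb P'(\{x:\langle u,x-z\rangle>0\})=p-\frac{k-1}{n}+\frac{\delta-\underline s_{k-1}/n}{y^{(-k)}}\in\Big[p-\frac kn,\;p-\frac{k-1}n\Big).$$ If $\underline s_{\underline m}\le\delta n$, then this infimum equals $0$. -/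

import Mathlib

open MeasureTheory
open scoped ENNReal

noncomputable section

/-- The couplings of two measures: joint laws on the product with the given marginals. -/
def couplings {E : Type*} [MeasurableSpace E] (P Q : Measure E) : Set (Measure (E × E)) :=
  {γ | γ.map Prod.fst = P ∧ γ.map Prod.snd = Q}

/-- The Wasserstein (earth mover's) distance with cost `‖x - y‖`, with values in `[0, ∞]`. -/
def wassersteinDist {E : Type*} [NormedAddCommGroup E] [MeasurableSpace E]
    (P Q : Measure E) : ℝ≥0∞ :=
  ⨅ γ ∈ couplings P Q, ∫⁻ q, ‖q.1 - q.2‖ₑ ∂γ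

/-- The ball of probability measures of radius `δ` (used for `0 ≤ δ`) centred at `P`. -/
def wassersteinBall {E : Type*} [NormedAddCommGroup E] [MeasurableSpace E]
    (P : Measure E) (δ : ℝ) : Set (ProbabilityMeasure E) :=
  {Q | wassersteinDist (Q : Measure E) P ≤ ENNReal.ofReal δ}

/-- The empirical law `(1/n) ∑ δ_{x i}`. -/
def empiricalLaw {E : Type*} [MeasurableSpace E] {n : ℕ} (x : Fin n → E) : Measure E :=
  (n : ℝ≥0∞)⁻¹ • ∑ i, Measure.dirac (x i)

/-- The closed halfspace `⟪u, w - z⟫ ≥ 0`. -/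
def closedHalfspace {d : ℕ} (u z : EuclideanSpace ℝ (Fin d)) : Set (EuclideanSpace ℝ (Fin d)) :=
  {w | 0 ≤ inner ℝ u (w - z)}

/-- The open halfspace `⟪u, w - z⟫ > 0`. -/
def openHalfspace {d : ℕ} (u z : EuclideanSpace ℝ (Fin d)) : Set (EuclideanSpace ℝ (Fin d)) :=
  {w | 0 < inner ℝ u (w - z)}

/-- The set of probabilities of `H` under the laws of the Wasserstein ball around `P`. -/
def ballProbabilities {d : ℕ} (P : Measure (EuclideanSpace ℝ (Fin d))) (δ : ℝ)
    (H : Set (EuclideanSpace ℝ (Fin d))) : Set ℝ :=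
  (fun Q : ProbabilityMeasure (EuclideanSpace ℝ (Fin d)) =>
    (Q : Measure (EuclideanSpace ℝ (Fin d))).real H) '' wassersteinBall P δ

/-- The projected observations `y_i = ⟪u, z - x_i⟫`, with multiplicity. -/
def projections {d n : ℕ} (x : Fin n → EuclideanSpace ℝ (Fin d))
    (u z : EuclideanSpace ℝ (Fin d)) : Multiset ℝ :=
  Finset.univ.val.map fun i => inner ℝ u (z - x i)

/-- The positive values of a finite family, `y^(1) ≤ y^(2) ≤ … ≤ y^(m)`. -/
def sortedPos (Y : Multiset ℝ) : List ℝ := (Y.filter (0 < ·)).sort (· ≤ ·)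

/-- The nonpositive values of a finite family, `y^(-1) ≥ y^(-2) ≥ …`, in decreasing order. -/
def sortedNonpos (Y : Multiset ℝ) : List ℝ := (Y.filter (· ≤ 0)).sort (· ≥ ·)

/-- The `k`-th entry of a list, counted from `1` (used for `1 ≤ k ≤ L.length`). -/
def entry (L : List ℝ) (k : ℕ) : ℝ := L.getD (k - 1) 0

/-- The sum of the first `k` entries; it is constant from `k = L.length` on. -/
def partialSum (L : List ℝ) (k : ℕ) : ℝ := (L.take k).sum

end

/-! By Cauchy–Schwarz, carrying a unit of mass from `x i` into the closed halfspace costs at least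
`max 0 y_i`, and moving along `u` attains this cost. The supremum is therefore a fractional
knapsack: choose fractions `t i ∈ [0, 1]` to maximize `(∑ t i) / n` under the budget `∑ t i * max 0
y_i ≤ δ * n`. The greedy solution moves the nearest atoms first and splits at a threshold `b =
y^(k)`.

Linear programming duality with price `b⁻¹` per unit of transport certifies optimality.
`measure_closedHalfspace_le` is weak duality against every law, `mem_ballProbabilities_of_plan`
realizes a plan inside the ball, and `isLUB_of_threshold` matches the two by complementary
slackness.

The infimum is the same problem for `-u`, because the open halfspace is the complement of the closed
halfspace with normal `-u`. -/

/-! ### Partial sums of an increasing list -/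

section SortedList

variable {L : List ℝ}

theorem pairwise_le_getD_of_mem_take (hs : L.Pairwise (· ≤ ·)) {j : ℕ} (hj : j < L.length) {a : ℝ}
    (ha : a ∈ L.take j) : a ≤ L.getD j 0 := by
  rw [List.mem_take_iff_getElem] at ha
  obtain ⟨i, hi, rfl⟩ := ha
  rw [List.getD_eq_getElem _ _ hj]
  exact List.pairwise_iff_getElem.1 hs i j _ hj (by omega)

theorem pairwise_getD_le_of_mem_drop (hs : L.Pairwise (· ≤ ·)) {j : ℕ} (hj : j < L.length) {a : ℝ}
    (ha : a ∈ L.drop j) : L.getD j 0 ≤ a := by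
  rw [List.mem_drop_iff_getElem] at ha
  obtain ⟨i, hi, rfl⟩ := ha
  rw [List.getD_eq_getElem _ _ hj]
  rcases Nat.eq_zero_or_pos i with h | h
  · subst h; simp
  · exact List.pairwise_iff_getElem.1 hs j (j + i) hj _ (by omega)

theorem sum_map_eq_take_add_drop (f : ℝ → ℝ) (j : ℕ) :
    (L.map f).sum = ((L.take j).map f).sum + ((L.drop j).map f).sum := by
  rw [← List.sum_append, ← List.map_append, List.take_append_drop]

theorem partialSum_succ {j : ℕ} (hj : j < L.length) :
    partialSum L (j + 1) = partialSum L j + L.getD j 0 := by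
  rw [partialSum, partialSum, List.sum_take_succ _ _ hj, List.getD_eq_getElem _ _ hj]

/-- Together with the next lemma this handles ties at the threshold: entries strictly below it lie
among the first `j`, while those at most it include the first `j + 1`. -/
theorem sum_map_lt_le_partialSum (hs : L.Pairwise (· ≤ ·)) (h0 : ∀ a ∈ L, 0 ≤ a) {j : ℕ}
    (hj : j < L.length) :
    (L.map fun a => if a < L.getD j 0 then a else 0).sum ≤ partialSum L j := by
  rw [sum_map_eq_take_add_drop _ j, partialSum]
  have h1 : ((L.drop j).map fun a => if a < L.getD j 0 then a else 0).sum = 0 := by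
    apply List.sum_eq_zero
    intro y hy
    obtain ⟨a, ha, rfl⟩ := List.mem_map.1 hy
    rw [if_neg (not_lt.2 (pairwise_getD_le_of_mem_drop hs hj ha))]
  have h2 : ((L.take j).map fun a => if a < L.getD j 0 then a else 0).sum ≤
      ((L.take j).map id).sum := by
    apply List.sum_le_sum
    intro a ha
    have := h0 a (List.mem_of_mem_take ha)
    split_ifs
    · exact le_rfl
    · exact this
  rw [List.map_id] at h2
  linarith

theorem partialSum_succ_le_sum_map_le (hs : L.Pairwise (· ≤ ·)) (h0 : ∀ a ∈ L, 0 ≤ a) {j : ℕ}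
    (hj : j < L.length) :
    partialSum L (j + 1) ≤ (L.map fun a => if a ≤ L.getD j 0 then a else 0).sum := by
  rw [sum_map_eq_take_add_drop _ (j + 1), partialSum]
  have h1 : 0 ≤ ((L.drop (j + 1)).map fun a => if a ≤ L.getD j 0 then a else 0).sum := by
    apply List.sum_nonneg
    intro y hy
    obtain ⟨a, ha, rfl⟩ := List.mem_map.1 hy
    have := h0 a (List.mem_of_mem_drop ha)
    split_ifs
    · exact this
    · exact le_rfl
  have h2 : ((L.take (j + 1)).map fun a => if a ≤ L.getD j 0 then a else 0) = L.take (j + 1) := by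
    conv_rhs => rw [← List.map_id (L.take (j + 1))]
    apply List.map_congr_left
    intro a ha
    rw [if_pos, id]
    rw [List.take_succ_eq_append_getElem hj, List.mem_append, List.mem_singleton] at ha
    rcases ha with ha | ha
    · exact pairwise_le_getD_of_mem_take hs hj ha
    · rw [ha, List.getD_eq_getElem _ _ hj]
  rw [h2]
  linarith

/-- At price `(L.getD j 0)⁻¹` the positive part is inactive on the first `j` entries and vanishes on
all later ones. -/
theorem sum_map_dual (hs : L.Pairwise (· ≤ ·)) {j : ℕ} (hj : j < L.length)
    (hb : 0 < L.getD j 0) :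
    (L.map fun a => max 0 (1 - (L.getD j 0)⁻¹ * a)).sum =
      j - (L.getD j 0)⁻¹ * partialSum L j := by
  rw [sum_map_eq_take_add_drop _ j, partialSum]
  have h1 : ((L.drop j).map fun a => max 0 (1 - (L.getD j 0)⁻¹ * a)).sum = 0 := by
    apply List.sum_eq_zero
    intro y hy
    obtain ⟨a, ha, rfl⟩ := List.mem_map.1 hy
    have := pairwise_getD_le_of_mem_drop hs hj ha
    apply max_eq_left
    rw [sub_nonpos, inv_mul_eq_div, le_div_iff₀ hb]
    linarith
  have h2 : ((L.take j).map fun a => max 0 (1 - (L.getD j 0)⁻¹ * a)) =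
      (L.take j).map fun a => 1 - (L.getD j 0)⁻¹ * a := by
    apply List.map_congr_left
    intro a ha
    have := pairwise_le_getD_of_mem_take hs hj ha
    apply max_eq_right
    rw [sub_nonneg, inv_mul_eq_div, div_le_iff₀ hb]
    linarith
  have h3 : ∀ (l : List ℝ) (c : ℝ), (l.map fun a => 1 - c * a).sum = l.length - c * l.sum := by
    intro l c
    induction l with
    | nil => simp
    | cons a l ih => simp [ih]; ring
  rw [h1, h2, h3, List.length_take, min_eq_left hj.le, add_zero]

end SortedList

/-! ### Transport duality for a halfspace -/

section Transport

variable {d n : ℕ} {x : Fin n → EuclideanSpace ℝ (Fin d)} {z u : EuclideanSpace ℝ (Fin d)} {δ : ℝ}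

theorem measurableSet_closedHalfspace (u z : EuclideanSpace ℝ (Fin d)) :
    MeasurableSet (closedHalfspace u z) :=
  (isClosed_le continuous_const (by fun_prop)).measurableSet

theorem compl_closedHalfspace_neg (u z : EuclideanSpace ℝ (Fin d)) :
    (closedHalfspace (-u) z)ᶜ = openHalfspace u z := by
  ext w
  simp [closedHalfspace, openHalfspace, inner_neg_left]

theorem mem_closedHalfspace_iff (u z w : EuclideanSpace ℝ (Fin d)) :
    w ∈ closedHalfspace u z ↔ inner ℝ u (z - w) ≤ 0 := by
  rw [closedHalfspace, Set.mem_ofPred_eq, ← neg_sub z w, inner_neg_right, Left.nonneg_neg_iff]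

theorem one_le_mul_norm_add_dual (hu : ‖u‖ = 1) {l : ℝ} (hl : 0 ≤ l)
    {w : EuclideanSpace ℝ (Fin d)} (hw : w ∈ closedHalfspace u z)
    (y : EuclideanSpace ℝ (Fin d)) :
    1 ≤ l * ‖w - y‖ + max 0 (1 - l * max 0 (inner ℝ u (z - y))) := by
  have h1 : inner ℝ u (w - y) ≤ ‖w - y‖ := by
    simpa [hu] using real_inner_le_norm u (w - y)
  have h2 : (inner ℝ u (w - y) : ℝ) = inner ℝ u (w - z) + inner ℝ u (z - y) := by
    rw [← inner_add_right, sub_add_sub_cancel]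
  have h3 : 0 ≤ (inner ℝ u (w - z) : ℝ) := hw
  have h4 : max 0 (inner ℝ u (z - y)) ≤ ‖w - y‖ := max_le (norm_nonneg _) (by linarith)
  have h5 := mul_le_mul_of_nonneg_left h4 hl
  have h6 := le_max_right 0 (1 - l * max 0 (inner ℝ u (z - y)))
  linarith

theorem lintegral_empiricalLaw {E : Type*} [MeasurableSpace E] (x : Fin n → E) {f : E → ℝ≥0∞}
    (hf : Measurable f) : ∫⁻ w, f w ∂(empiricalLaw x) = (n : ℝ≥0∞)⁻¹ * ∑ i, f (x i) := by
  rw [empiricalLaw, lintegral_smul_measure, lintegral_finsetSum_measure]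
  simp [lintegral_dirac' _ hf]

/-- Weak duality: a price `l` per unit of transport bounds the probability of the halfspace. -/
theorem measure_closedHalfspace_le (hu : ‖u‖ = 1) {l : ℝ} (hl : 0 < l)
    (Q : Measure (EuclideanSpace ℝ (Fin d))) :
    Q (closedHalfspace u z) ≤ ENNReal.ofReal l * wassersteinDist Q (empiricalLaw x) +
      (n : ℝ≥0∞)⁻¹ * ∑ i, ENNReal.ofReal (max 0 (1 - l * max 0 (inner ℝ u (z - x i)))) := by
  have hg : Measurable fun w => ENNReal.ofReal (max 0 (1 - l * max 0 (inner ℝ u (z - w)))) := by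
    fun_prop
  rw [← lintegral_empiricalLaw x hg]
  have hl0 : ENNReal.ofReal l ≠ 0 := by simpa using hl
  -- Subtracting the dual term isolates the infimum, so that it suffices to integrate the pointwise
  -- bound `one_le_mul_norm_add_dual` against each coupling.
  rw [← tsub_le_iff_right, wassersteinDist]
  rw [ENNReal.mul_iInf_of_ne hl0 ENNReal.ofReal_ne_top]
  refine le_iInf fun γ => ?_
  rw [ENNReal.mul_iInf_of_ne hl0 ENNReal.ofReal_ne_top]
  refine le_iInf fun hγ => ?_
  rw [tsub_le_iff_right, ← hγ.1, ← hγ.2, lintegral_map hg measurable_snd,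
    Measure.map_apply measurable_fst (measurableSet_closedHalfspace u z),
    ← lintegral_const_mul _ (by fun_prop), ← lintegral_add_left (by fun_prop),
    ← lintegral_indicator_one (measurable_fst (measurableSet_closedHalfspace u z))]
  refine lintegral_mono fun q => ?_
  by_cases hq : q.1 ∈ closedHalfspace u z
  · rw [Set.indicator_of_mem (by exact hq), Pi.one_apply, ← ofReal_norm,
      ← ENNReal.ofReal_mul hl.le, ← ENNReal.ofReal_add (by positivity) (le_max_left _ _),
      ENNReal.one_le_ofReal]
    exact one_le_mul_norm_add_dual hu hl.le hq q.2
  · rw [Set.indicator_of_notMem (by exact hq)]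
    exact zero_le

theorem inv_natCast_mul_sum_ofReal (hn : 1 ≤ n) {f : Fin n → ℝ} (hf : ∀ i, 0 ≤ f i) :
    (n : ℝ≥0∞)⁻¹ * ∑ i, ENNReal.ofReal (f i) = ENNReal.ofReal ((∑ i, f i) / n) := by
  rw [← ENNReal.ofReal_sum_of_nonneg fun i _ => hf i, ENNReal.ofReal_div_of_pos (by positivity),
    ENNReal.ofReal_natCast, ENNReal.div_eq_inv_mul]

theorem le_of_mem_ballProbabilities (hn : 1 ≤ n) (hu : ‖u‖ = 1) (hδ : 0 ≤ δ) {l : ℝ} (hl : 0 < l)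
    {v : ℝ} (hv : v ∈ ballProbabilities (empiricalLaw x) δ (closedHalfspace u z)) :
    v ≤ l * δ + (∑ i, max 0 (1 - l * max 0 (inner ℝ u (z - x i)))) / n := by
  obtain ⟨Q, hQ, rfl⟩ := hv
  have h := measure_closedHalfspace_le (x := x) (z := z) hu hl (Q : Measure _)
  have h0 : 0 ≤ (∑ i, max 0 (1 - l * max 0 (inner ℝ u (z - x i)))) / (n : ℝ) :=
    div_nonneg (Finset.sum_nonneg fun i _ => le_max_left _ _) (Nat.cast_nonneg _)
  rw [inv_natCast_mul_sum_ofReal hn fun i => le_max_left _ _] at h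
  refine ENNReal.toReal_le_of_le_ofReal (by positivity) (h.trans ?_)
  rw [ENNReal.ofReal_add (by positivity) h0, ENNReal.ofReal_mul hl.le]
  gcongr
  exact hQ

/-- The law which moves the fraction `t i` of the atom `x i` to `w i`. -/
noncomputable def splitLaw {E : Type*} [MeasurableSpace E] (t : Fin n → ℝ) (w x : Fin n → E) :
    Measure E :=
  (n : ℝ≥0∞)⁻¹ • ∑ i, (ENNReal.ofReal (t i) • Measure.dirac (w i) +
    ENNReal.ofReal (1 - t i) • Measure.dirac (x i))

theorem map_splitLaw {E F : Type*} [MeasurableSpace E] [MeasurableSpace F] (t : Fin n → ℝ)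
    (w x : Fin n → E) {f : E → F} (hf : Measurable f) :
    (splitLaw t w x).map f = splitLaw t (f ∘ w) (f ∘ x) := by
  simp only [splitLaw, ← Measure.mapₗ_apply_of_measurable hf, map_sum, map_add,
    map_smul]
  simp only [Measure.mapₗ_apply_of_measurable hf, Measure.map_dirac' hf, Function.comp]

theorem ofReal_add_ofReal_one_sub {t : ℝ} (h0 : 0 ≤ t) (h1 : t ≤ 1) :
    ENNReal.ofReal t + ENNReal.ofReal (1 - t) = 1 := by
  rw [← ENNReal.ofReal_add h0 (by linarith), add_sub_cancel, ENNReal.ofReal_one]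

theorem splitLaw_self {E : Type*} [MeasurableSpace E] {t : Fin n → ℝ} (h0 : ∀ i, 0 ≤ t i)
    (h1 : ∀ i, t i ≤ 1) (x : Fin n → E) : splitLaw t x x = empiricalLaw x := by
  simp only [splitLaw, empiricalLaw, ← add_smul, ofReal_add_ofReal_one_sub (h0 _) (h1 _), one_smul]

theorem isProbabilityMeasure_splitLaw {E : Type*} [MeasurableSpace E] (hn : 1 ≤ n) {t : Fin n → ℝ}
    (h0 : ∀ i, 0 ≤ t i) (h1 : ∀ i, t i ≤ 1) (w x : Fin n → E) :
    IsProbabilityMeasure (splitLaw t w x) := by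
  constructor
  simp only [splitLaw, Measure.smul_apply, Measure.finsetSum_apply, Measure.add_apply,
    measure_univ, smul_eq_mul, mul_one, ofReal_add_ofReal_one_sub (h0 _) (h1 _), Finset.sum_const,
    Finset.card_univ, Fintype.card_fin, nsmul_eq_mul]
  exact ENNReal.inv_mul_cancel (by simp; omega) (ENNReal.natCast_ne_top n)

theorem wassersteinDist_splitLaw_le (hn : 1 ≤ n) {t : Fin n → ℝ}
    (h0 : ∀ i, 0 ≤ t i) (h1 : ∀ i, t i ≤ 1) (w x : Fin n → EuclideanSpace ℝ (Fin d)) :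
    wassersteinDist (splitLaw t w x) (empiricalLaw x) ≤
      ENNReal.ofReal ((∑ i, t i * ‖w i - x i‖) / n) := by
  -- The unmoved fraction stays on the diagonal and costs nothing.
  have hγ : splitLaw t (fun i => (w i, x i)) (fun i => (x i, x i)) ∈
      couplings (splitLaw t w x) (empiricalLaw x) := by
    refine ⟨map_splitLaw _ _ _ measurable_fst, ?_⟩
    rw [map_splitLaw _ _ _ measurable_snd]
    exact splitLaw_self h0 h1 x
  refine (iInf₂_le _ hγ).trans ?_
  rw [← inv_natCast_mul_sum_ofReal hn fun i => mul_nonneg (h0 i) (norm_nonneg _), splitLaw,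
    lintegral_smul_measure, lintegral_finsetSum_measure]
  simp [lintegral_add_measure, lintegral_smul_measure, lintegral_dirac, ENNReal.ofReal_mul, h0]

theorem splitLaw_real_apply {E : Type*} [MeasurableSpace E] {t : Fin n → ℝ}
    (h0 : ∀ i, 0 ≤ t i) {w x : Fin n → E} {H : Set E} (hH : MeasurableSet H)
    (hw : ∀ i, w i ∈ H) (hx : ∀ i, x i ∈ H → t i = 1) (hn : 1 ≤ n) :
    (splitLaw t w x).real H = (∑ i, t i) / n := by
  have h : splitLaw t w x H = (n : ℝ≥0∞)⁻¹ * ∑ i, ENNReal.ofReal (t i) := by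
    simp only [splitLaw, Measure.smul_apply, Measure.finsetSum_apply, Measure.add_apply,
      smul_eq_mul, Measure.dirac_apply' _ hH]
    congr 1
    refine Finset.sum_congr rfl fun i _ => ?_
    rw [Set.indicator_of_mem (hw i)]
    by_cases hi : x i ∈ H
    · simp [hx i hi]
    · simp [hi]
  rw [Measure.real, h, inv_natCast_mul_sum_ofReal hn h0,
    ENNReal.toReal_ofReal (div_nonneg (Finset.sum_nonneg fun i _ => h0 i) (Nat.cast_nonneg _))]

theorem mem_ballProbabilities_of_plan (hn : 1 ≤ n) (hu : ‖u‖ = 1) {t : Fin n → ℝ}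
    (h0 : ∀ i, 0 ≤ t i) (h1 : ∀ i, t i ≤ 1) (ht : ∀ i, inner ℝ u (z - x i) ≤ 0 → t i = 1)
    (hc : (∑ i, t i * max 0 (inner ℝ u (z - x i))) ≤ δ * n) :
    (∑ i, t i) / n ∈ ballProbabilities (empiricalLaw x) δ (closedHalfspace u z) := by
  -- `w i` is the nearest point of the halfspace, at distance `max 0 y_i` from `x i`.
  set w : Fin n → EuclideanSpace ℝ (Fin d) := fun i => x i + max 0 (inner ℝ u (z - x i)) • u
    with hw
  refine ⟨⟨splitLaw t w x, isProbabilityMeasure_splitLaw hn h0 h1 w x⟩, ?_, ?_⟩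
  · refine (wassersteinDist_splitLaw_le hn h0 h1 w x).trans (ENNReal.ofReal_le_ofReal ?_)
    rw [div_le_iff₀ (by positivity)]
    refine le_of_eq_of_le (Finset.sum_congr rfl fun i _ => ?_) hc
    simp [hw, norm_smul, hu]
  · refine splitLaw_real_apply h0 (measurableSet_closedHalfspace u z) (fun i => ?_)
      (fun i hi => ht i ((mem_closedHalfspace_iff u z _).1 hi)) hn
    rw [mem_closedHalfspace_iff, hw, ← sub_sub, inner_sub_right, inner_smul_right,
      real_inner_self_eq_norm_sq, hu]
    simp

/-- The fraction transported from an atom at depth `a`, for the threshold `b`. -/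
noncomputable def thresholdPlan (b τ a : ℝ) : ℝ := if a < b then 1 else if a = b then τ else 0

theorem isLUB_of_threshold (hn : 1 ≤ n) (hu : ‖u‖ = 1) (hδ : 0 ≤ δ) {b : ℝ} (hb : 0 < b)
    (hlo : (∑ i, if inner ℝ u (z - x i) < b then max 0 (inner ℝ u (z - x i)) else 0) ≤ δ * n)
    (hhi : δ * n ≤ ∑ i, if inner ℝ u (z - x i) ≤ b then max 0 (inner ℝ u (z - x i)) else 0) :
    IsLUB (ballProbabilities (empiricalLaw x) δ (closedHalfspace u z))
      (b⁻¹ * δ + (∑ i, max 0 (1 - b⁻¹ * max 0 (inner ℝ u (z - x i)))) / n) := by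
  have hn' : (0 : ℝ) < n := by positivity
  obtain ⟨τ, ⟨hτ0, hτ1⟩, hτ⟩ : ∃ τ ∈ Set.Icc (0 : ℝ) 1, (∑ i, thresholdPlan b τ
      (inner ℝ u (z - x i)) * max 0 (inner ℝ u (z - x i))) = δ * n := by
    have hcont : ContinuousOn (fun τ : ℝ => ∑ i, thresholdPlan b τ
      (inner ℝ u (z - x i)) * max 0 (inner ℝ u (z - x i))) (Set.Icc 0 1) := by
      refine continuousOn_finsetSum _ fun i _ => ContinuousOn.mul ?_ continuousOn_const
      unfold thresholdPlan
      split_ifs <;> fun_prop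
    -- The cost at `τ = 0` is the sum in `hlo` and at `τ = 1` the sum in `hhi`, so some `τ` spends
    -- the budget exactly.
    refine intermediate_value_Icc zero_le_one hcont ⟨?_, ?_⟩
    · refine le_of_eq_of_le (Finset.sum_congr rfl fun i _ => ?_) hlo
      simp only [thresholdPlan, ite_self, ite_mul, one_mul, zero_mul]
    · refine le_of_le_of_eq hhi (Finset.sum_congr rfl fun i _ => ?_)
      simp only [thresholdPlan, ite_mul, one_mul, zero_mul]
      split_ifs <;> first | rfl | (exfalso; grind)
  -- Complementary slackness: at `a = b` both sides vanish whatever `τ` is, so splitting the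
  -- threshold atoms loses nothing.
  have hslack : ∀ a : ℝ, max 0 (1 - b⁻¹ * max 0 a) =
      thresholdPlan b τ a - b⁻¹ * (thresholdPlan b τ a * max 0 a) := by
    intro a
    unfold thresholdPlan
    split_ifs with h1 h2
    · rw [one_mul, max_eq_right]
      rw [sub_nonneg, inv_mul_eq_div, div_le_iff₀ hb, one_mul]
      exact max_le hb.le h1.le
    · subst h2
      rw [max_eq_right hb.le, inv_mul_cancel₀ hb.ne', sub_self, max_self]
      field_simp
      ring
    · rw [zero_mul, mul_zero, sub_zero, max_eq_left]
      rw [sub_nonpos, inv_mul_eq_div, le_div_iff₀ hb, one_mul]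
      exact (not_lt.1 h1).trans (le_max_right _ _)
  refine IsGreatest.isLUB ⟨?_, fun v hv => le_of_mem_ballProbabilities hn hu hδ (inv_pos.2 hb) hv⟩
  have hv : b⁻¹ * δ + (∑ i, max 0 (1 - b⁻¹ * max 0 (inner ℝ u (z - x i)))) / n =
      (∑ i, thresholdPlan b τ (inner ℝ u (z - x i))) / n := by
    simp only [hslack, Finset.sum_sub_distrib, ← Finset.mul_sum, hτ]
    field_simp
    ring
  rw [hv]
  refine mem_ballProbabilities_of_plan hn hu (fun i => ?_) (fun i => ?_) (fun i hi => ?_) hτ.le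
  · unfold thresholdPlan
    split_ifs <;> first | exact hτ0 | norm_num
  · unfold thresholdPlan
    split_ifs <;> first | exact hτ1 | norm_num
  · rw [thresholdPlan, if_pos (hi.trans_lt hb)]

end Transport

/-! ### From sums over the sample to sorted values -/

section HalfspaceProbability

variable {d n : ℕ} {x : Fin n → EuclideanSpace ℝ (Fin d)} {z u : EuclideanSpace ℝ (Fin d)} {δ : ℝ}
  {P : ℝ → Prop} [DecidablePred P] {L : List ℝ}

theorem card_projections (x : Fin n → EuclideanSpace ℝ (Fin d))
    (u z : EuclideanSpace ℝ (Fin d)) : (projections x u z).card = n := by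
  simp [projections]

theorem sum_projections (x : Fin n → EuclideanSpace ℝ (Fin d))
    (u z : EuclideanSpace ℝ (Fin d)) (f : ℝ → ℝ) :
    ∑ i, f (inner ℝ u (z - x i)) = ((projections x u z).map f).sum := by
  rw [projections, Multiset.map_map]
  rfl

theorem sum_eq_sum_list_add (hL : (L : Multiset ℝ) = (projections x u z).filter P) {f : ℝ → ℝ}
    {c : ℝ} (hf : ∀ a, ¬ P a → f a = c) :
    ∑ i, f (inner ℝ u (z - x i)) = (L.map f).sum + (n - L.length) * c := by
  have hcard := congrArg Multiset.card (Multiset.filter_add_not P (projections x u z))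
  rw [sum_projections, ← Multiset.filter_add_not P (projections x u z), Multiset.map_add,
    Multiset.sum_add, ← hL, Multiset.map_coe, Multiset.sum_coe,
    Multiset.map_congr rfl fun a ha => hf a (Multiset.mem_filter.1 ha).2, Multiset.map_const',
    Multiset.sum_replicate, nsmul_eq_mul]
  rw [Multiset.card_add, card_projections, ← hL, Multiset.coe_card] at hcard
  have hcard' := congrArg (Nat.cast (R := ℝ)) hcard
  push_cast at hcard'
  rw [← eq_sub_iff_add_eq'.2 hcard']

/-- Whether `P` keeps atoms of depth zero is left open: they are free to move. Thus one statement
serves the positive values for `u` and, after negation, the nonpositive values for `-u`. -/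
theorem isLUB_ballProbabilities_closedHalfspace (hn : 1 ≤ n) (hu : ‖u‖ = 1) (hδ : 0 ≤ δ)
    (hP : ∀ a, 0 < a → P a) (hP' : ∀ a, P a → 0 ≤ a) (hs : L.Pairwise (· ≤ ·))
    (hL : (L : Multiset ℝ) = (projections x u z).filter P) {k : ℕ} (hk : 1 ≤ k)
    (hkL : k ≤ L.length) (h1 : partialSum L (k - 1) < δ * n) (h2 : δ * n ≤ partialSum L k) :
    0 < entry L k ∧ δ - partialSum L (k - 1) / n ≤ entry L k / n ∧
    IsLUB (ballProbabilities (empiricalLaw x) δ (closedHalfspace u z))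
      ((n - L.length : ℝ) / n + ((k : ℝ) - 1) / n +
        (δ - partialSum L (k - 1) / n) / entry L k) := by
  obtain ⟨j, rfl⟩ : ∃ j, k = j + 1 := ⟨k - 1, by omega⟩
  have hn' : (0 : ℝ) < n := by positivity
  have hj : j < L.length := hkL
  have h0 : ∀ a ∈ L, 0 ≤ a := fun a ha => by
    rw [← Multiset.mem_coe, hL] at ha
    exact hP' a (Multiset.mem_filter.1 ha).2
  have hsucc := partialSum_succ hj
  simp only [Nat.add_sub_cancel, entry] at *
  -- The strict lower bound on `δ * n` excludes a zero entry here, even if `L` contains zeros.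
  have hb : 0 < L.getD j 0 := by linarith
  have hneg : ∀ a, ¬ P a → max 0 a = 0 := fun a ha => max_eq_left (not_lt.1 fun h => ha (hP a h))
  have hmax : ∀ a ∈ L, max 0 a = a := fun a ha => max_eq_right (h0 a ha)
  refine ⟨hb, ?_, ?_⟩
  · rw [le_div_iff₀ hn', sub_mul, div_mul_cancel₀ _ hn'.ne']
    linarith
  have key := isLUB_of_threshold (x := x) (z := z) hn hu hδ hb ?_ ?_
  · rw [sum_eq_sum_list_add hL (f := fun a => max 0 (1 - (L.getD j 0)⁻¹ * max 0 a)) (c := 1)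
      (fun a ha => by simp [hneg a ha]),
      List.map_congr_left (g := fun a => max 0 (1 - (L.getD j 0)⁻¹ * a))
        (fun a ha => by rw [hmax a ha]), sum_map_dual hs hj hb] at key
    convert key using 1
    push_cast
    field_simp
    ring
  · rw [sum_eq_sum_list_add hL (f := fun a => if a < L.getD j 0 then max 0 a else 0) (c := 0)
      (fun a ha => by simp [hneg a ha]),
      List.map_congr_left (g := fun a => if a < L.getD j 0 then a else 0)
        (fun a ha => by rw [hmax a ha])]
    have := sum_map_lt_le_partialSum hs h0 hj
    linarith
  · rw [sum_eq_sum_list_add hL (f := fun a => if a ≤ L.getD j 0 then max 0 a else 0) (c := 0)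
      (fun a ha => by simp [hneg a ha]),
      List.map_congr_left (g := fun a => if a ≤ L.getD j 0 then a else 0)
        (fun a ha => by rw [hmax a ha])]
    have := partialSum_succ_le_sum_map_le hs h0 hj
    linarith

theorem isLUB_ballProbabilities_closedHalfspace_one (hn : 1 ≤ n) (hu : ‖u‖ = 1)
    (hP : ∀ a, 0 < a → P a) (hP' : ∀ a, P a → 0 ≤ a)
    (hL : (L : Multiset ℝ) = (projections x u z).filter P)
    (h : partialSum L L.length ≤ δ * n) :
    IsLUB (ballProbabilities (empiricalLaw x) δ (closedHalfspace u z)) 1 := by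
  refine IsGreatest.isLUB ⟨?_, ?_⟩
  · have key := mem_ballProbabilities_of_plan (x := x) (z := z) (δ := δ) hn hu (t := fun _ => 1)
      (fun _ => zero_le_one) (fun _ => le_rfl) (fun _ _ => rfl) ?_
    · have hn' : (n : ℝ) ≠ 0 := by positivity
      simpa [hn'] using key
    · simp only [one_mul]
      rw [sum_eq_sum_list_add hL (f := fun a => max 0 a) (c := 0)
        (fun a ha => max_eq_left (not_lt.1 fun h => ha (hP a h))),
        List.map_congr_left (g := fun a => a) fun a ha => max_eq_right ?_]
      · simpa [partialSum] using h
      · rw [← Multiset.mem_coe, hL] at ha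
        exact hP' a (Multiset.mem_filter.1 ha).2
  · rintro _ ⟨Q, -, rfl⟩
    exact measureReal_le_one

theorem isGLB_openHalfspace_of_isLUB {μ : Measure (EuclideanSpace ℝ (Fin d))} {v : ℝ}
    (h : IsLUB (ballProbabilities μ δ (closedHalfspace (-u) z)) v) :
    IsGLB (ballProbabilities μ δ (openHalfspace u z)) (1 - v) := by
  have hQ : ∀ Q : ProbabilityMeasure (EuclideanSpace ℝ (Fin d)),
      (Q : Measure _).real (openHalfspace u z) =
        1 - (Q : Measure _).real (closedHalfspace (-u) z) := fun Q => by
    rw [← compl_closedHalfspace_neg, probReal_compl_eq_one_sub (measurableSet_closedHalfspace _ _)]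
  constructor
  · rintro _ ⟨Q, hQb, rfl⟩
    have := h.1 ⟨Q, hQb, rfl⟩
    simp only [hQ] at this ⊢
    linarith
  · intro b hb
    have : v ≤ 1 - b := h.2 <| by
      rintro _ ⟨Q, hQb, rfl⟩
      have := hb ⟨Q, hQb, rfl⟩
      simp only [hQ] at this ⊢
      linarith
    linarith

theorem empiricalLaw_real_closedHalfspace :
    (empiricalLaw x).real (closedHalfspace u z) =
      ((projections x u z).filter (· ≤ 0)).card / n := by
  have hH := measurableSet_closedHalfspace u z
  rw [Measure.real, ← lintegral_indicator_one hH,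
    lintegral_empiricalLaw x (measurable_one.indicator hH), projections, Multiset.filter_map,
    Multiset.card_map]
  have hsum : ∑ i, (closedHalfspace u z).indicator (1 : EuclideanSpace ℝ (Fin d) → ℝ≥0∞) (x i) =
      ((Finset.univ.filter fun i => inner ℝ u (z - x i) ≤ 0).card : ℝ≥0∞) := by
    rw [Finset.natCast_card_filter]
    refine Finset.sum_congr rfl fun i _ => ?_
    by_cases h : x i ∈ closedHalfspace u z
    · rw [Set.indicator_of_mem h, if_pos ((mem_closedHalfspace_iff u z _).1 h), Pi.one_apply]
    · rw [Set.indicator_of_notMem h, if_neg fun h' => h ((mem_closedHalfspace_iff u z _).2 h')]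
  rw [hsum, ENNReal.toReal_mul, ENNReal.toReal_inv, ENNReal.toReal_natCast,
    ENNReal.toReal_natCast, inv_mul_eq_div]
  rfl

theorem projections_neg (x : Fin n → EuclideanSpace ℝ (Fin d))
    (u z : EuclideanSpace ℝ (Fin d)) :
    projections x (-u) z = (projections x u z).map (- ·) := by
  simp [projections, inner_neg_left, Function.comp_def]

theorem sum_map_neg_list (L : List ℝ) : (L.map (- ·)).sum = -L.sum := by
  induction L with
  | nil => simp
  | cons a L ih => simp [ih]; ring

theorem partialSum_map_neg (L : List ℝ) (k : ℕ) :
    partialSum (L.map (- ·)) k = -partialSum L k := by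
  rw [partialSum, partialSum, ← List.map_take, sum_map_neg_list]

theorem entry_map_neg (L : List ℝ) (k : ℕ) : entry (L.map (- ·)) k = -entry L k := by
  rw [entry, entry, ← List.getD_map (f := fun a : ℝ => -a), neg_zero]

end HalfspaceProbability

/-! ### The supremum and infimum formulas -/

theorem corollary1 {d n : ℕ} (hn : 1 ≤ n) (x : Fin n → EuclideanSpace ℝ (Fin d))
    (z u : EuclideanSpace ℝ (Fin d)) (hu : ‖u‖ = 1) (δ : ℝ) (hδ : 0 ≤ δ)
    (p : ℝ) (hp : p = (empiricalLaw x).real (closedHalfspace u z))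
    (pos neg : List ℝ) (hpos : pos = sortedPos (projections x u z))
    (hneg : neg = sortedNonpos (projections x u z)) :
    (∀ k : ℕ, 1 ≤ k → k ≤ pos.length →
      partialSum pos (k - 1) < δ * n → δ * n ≤ partialSum pos k →
      ∃ v : ℝ, IsLUB (ballProbabilities (empiricalLaw x) δ (closedHalfspace u z)) v ∧
        v = p + ((k : ℝ) - 1) / n + (δ - partialSum pos (k - 1) / n) / entry pos k ∧
        v ∈ Set.Ioc (p + ((k : ℝ) - 1) / n) (p + (k : ℝ) / n)) ∧
    (partialSum pos pos.length ≤ δ * n →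
      IsLUB (ballProbabilities (empiricalLaw x) δ (closedHalfspace u z)) 1) ∧
    (∀ k : ℕ, 1 ≤ k → k ≤ neg.length →
      -partialSum neg (k - 1) < δ * n → δ * n ≤ -partialSum neg k →
      ∃ v : ℝ, IsGLB (ballProbabilities (empiricalLaw x) δ (openHalfspace u z)) v ∧
        v = p - ((k : ℝ) - 1) / n + (δ - (-partialSum neg (k - 1)) / n) / entry neg k ∧
        v ∈ Set.Ico (p - (k : ℝ) / n) (p - ((k : ℝ) - 1) / n)) ∧
    (-partialSum neg neg.length ≤ δ * n →
      IsGLB (ballProbabilities (empiricalLaw x) δ (openHalfspace u z)) 0) := by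
  have hn' : (0 : ℝ) < n := by positivity
  have hposL : (pos : Multiset ℝ) = (projections x u z).filter (0 < ·) := by
    rw [hpos, sortedPos, Multiset.sort_eq]
  have hposS : pos.Pairwise (· ≤ ·) := hpos ▸ Multiset.pairwise_sort _ _
  have hnegL' : (neg : Multiset ℝ) = (projections x u z).filter (· ≤ 0) := by
    rw [hneg, sortedNonpos, Multiset.sort_eq]
  -- Negation turns the decreasing nonpositive values for `u` into the increasing nonnegative depths
  -- for `-u`, zeros included.
  have hnegL : ((neg.map (- ·) : List ℝ) : Multiset ℝ) =
      (projections x (-u) z).filter (0 ≤ ·) := by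
    rw [projections_neg, Multiset.filter_map, ← Multiset.map_coe, hnegL']
    simp
  have hnegS : (neg.map (- ·)).Pairwise (· ≤ ·) := by
    have h : neg.Pairwise (· ≥ ·) := hneg ▸ Multiset.pairwise_sort _ _
    exact h.map _ fun a b hab => neg_le_neg hab
  have hpneg : p = neg.length / n := by
    rw [hp, empiricalLaw_real_closedHalfspace, ← hnegL', Multiset.coe_card]
  have hcard : (neg.length : ℝ) = n - pos.length := by
    have h := congrArg Multiset.card
      (Multiset.filter_add_not (fun a : ℝ => 0 < a) (projections x u z))
    simp only [not_lt] at h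
    rw [Multiset.card_add, card_projections, ← hposL, ← hnegL', Multiset.coe_card,
      Multiset.coe_card] at h
    rw [← h]
    push_cast
    ring
  have hu' : ‖-u‖ = 1 := by rwa [norm_neg]
  refine ⟨fun k hk hkL h1 h2 => ?_, fun h => ?_, fun k hk hkL h1 h2 => ?_, fun h => ?_⟩
  · obtain ⟨hb, hle, hlub⟩ := isLUB_ballProbabilities_closedHalfspace hn hu hδ (fun a ha => ha)
      (fun a ha => ha.le) hposS hposL hk hkL h1 h2
    rw [← hcard, ← hpneg] at hlub
    have hlt : 0 < (δ - partialSum pos (k - 1) / n) / entry pos k :=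
      div_pos (by rwa [sub_pos, div_lt_iff₀ hn']) hb
    have hle' : (δ - partialSum pos (k - 1) / n) / entry pos k ≤ 1 / n := by
      rw [div_le_iff₀ hb, one_div_mul_eq_div]
      exact hle
    have hk' : (k : ℝ) / n = ((k : ℝ) - 1) / n + 1 / n := by ring
    exact ⟨_, hlub, rfl, by linarith, by linarith⟩
  · exact isLUB_ballProbabilities_closedHalfspace_one hn hu (fun a ha => ha)
      (fun a ha => ha.le) hposL h
  · obtain ⟨hb, hle, hlub⟩ := isLUB_ballProbabilities_closedHalfspace hn hu' hδ
      (fun a ha => ha.le) (fun a ha => ha) hnegS hnegL hk (by rwa [List.length_map])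
      (by rwa [partialSum_map_neg]) (by rwa [partialSum_map_neg])
    have hglb := isGLB_openHalfspace_of_isLUB hlub
    rw [entry_map_neg, partialSum_map_neg] at hle
    rw [entry_map_neg, partialSum_map_neg, List.length_map] at hglb
    rw [entry_map_neg] at hb
    have hlt : (δ - -partialSum neg (k - 1) / n) / entry neg k < 0 :=
      div_neg_of_pos_of_neg (by rwa [sub_pos, div_lt_iff₀ hn']) (neg_pos.1 hb)
    have hle' : -(1 / n) ≤ (δ - -partialSum neg (k - 1) / n) / entry neg k := by
      rw [le_div_iff_of_neg (neg_pos.1 hb), neg_mul, one_div_mul_eq_div, ← neg_div]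
      exact hle
    have hk' : (k : ℝ) / n = ((k : ℝ) - 1) / n + 1 / n := by ring
    refine ⟨_, hglb, ?_, ?_⟩
    · rw [hpneg, div_neg]
      field_simp
      ring
    · have hv : 1 - ((n - neg.length : ℝ) / n + ((k : ℝ) - 1) / n +
          (δ - -partialSum neg (k - 1) / n) / -entry neg k) =
          p - ((k : ℝ) - 1) / n + (δ - -partialSum neg (k - 1) / n) / entry neg k := by
        rw [hpneg, div_neg, sub_div, div_self hn'.ne']
        ring
      rw [hv]
      constructor <;> linarith
  · have hlub := isLUB_ballProbabilities_closedHalfspace_one (δ := δ) hn hu' (fun a ha => ha.le)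
      (fun a ha => ha) hnegL (by rwa [partialSum_map_neg, List.length_map])
    simpa using isGLB_openHalfspace_of_isLUB hlub
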